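/- A probability mass function $p$ on $\mathbb{Z}$ is called log-concave if $p(k)^2\ge p(k-1)p(k+1)$ for every $k\in\mathbb{Z}$ and its support $\{k : p(k)>0\}$ is an interval of integers (has no gaps); an integer-valued random variable is log-concave if its probability mass function is. Write $H(X)=-\sum_{k} p(k)\log p(k)$ for the Shannon entropy of an integer-valued random variable with probability mass function $p$, and $h(Y)=-\int_{\mathbb{R}} f\log f$ for the differential entropy of a real random variable with density $f$ ($\log$ is the natural logarithm). Let $n\ge 1$, let $X_1,\dots,X_n$ be i.i.d. log-concave integer-valued random variables, with common variance $\sigma^2$ ($\sigma\ge 0$), and let $U_1,\dots,U_n$ be i.i.d. uniform on $(0,1)$, independent of $(X_1,\dots,X_n)$. Put $S_n=X_1+\dots+X_n$. Then $\sigma^2<\infty$, $S_n+U_1+\dots+U_n$ has a density, and $H(S_n)$ and $h(S_n+U_1+\dots+U_n)$ are well defined and finite. Moreover $$h(S_n+U_1+\dots+U_n)=H(S_n)+o(1)\quad\text{as }\sigma\to\infty,$$ where the $o(1)$ is uniform for fixed $n$: for every $\varepsilon>0$ there is a $\sigma_0$ depending only on $n$ and $\varepsilon$ such that $|h(S_n+U_1+\dots+U_n)-H(S_n)|\le\varepsilon$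 whenever $\sigma>\sigma_0$. Explicitly, if $\sigma>\max\{2^{n+2}/\sqrt n,\,3^7/\sqrt n\}$, then $$\bigl|h(S_n+U_1+\dots+U_n)-H(S_n)\bigr|\le 2^{n+6}e^{-(\sqrt n\,\sigma)^{1/5}}(\sqrt n\,\sigma)^3+\frac{2^{n+2}}{\sigma\sqrt n}\log\bigl(2^{n+2}\sigma\sqrt n\bigr)+\frac{\log(n\sigma^2)}{8n\sigma^2}.$$ -/

import Mathlib

open MeasureTheory ProbabilityTheory

universe u

noncomputable section

namespace LogConcaveSums

/-- The probability mass function `k ↦ P(X = k)` of an integer-valued random variable. -/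
def pmfZ {Ω : Type*} [MeasurableSpace Ω] (μ : Measure Ω) (X : Ω → ℤ) (k : ℤ) : ℝ :=
  μ.real (X ⁻¹' {k})

/-- Log-concavity of a probability mass function on the integers: `p(k)² ≥ p(k-1) p(k+1)` for all
`k`, and the support has no gaps (it is an interval of integers). -/
def IsLogConcave (p : ℤ → ℝ) : Prop :=
  (∀ k : ℤ, p (k - 1) * p (k + 1) ≤ p k ^ 2) ∧ (Function.support p).OrdConnected

/-- Shannon entropy `H(X) = -∑ₖ p(k) log p(k)` (natural logarithm, `0 log 0 = 0`). -/
def shannonEntropy {Ω : Type*} [MeasurableSpace Ω] (μ : Measure Ω) (X : Ω → ℤ) : ℝ :=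
  ∑' k : ℤ, Real.negMulLog (pmfZ μ X k)

/-- The density (with respect to Lebesgue measure) of a real random variable, as a real function. -/
def density {Ω : Type*} [MeasurableSpace Ω] (μ : Measure Ω) (Y : Ω → ℝ) (x : ℝ) : ℝ :=
  (pdf Y μ volume x).toReal

/-- Differential entropy `h(Y) = -∫ f(x) log f(x) dx`, where `f` is the density of `Y`. -/
def differentialEntropy {Ω : Type*} [MeasurableSpace Ω] (μ : Measure Ω) (Y : Ω → ℝ) : ℝ :=
  ∫ x, Real.negMulLog (density μ Y x)

/-- `S = X₁ + ⋯ + Xₙ`. -/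
def sumX {Ω : Type*} {n : ℕ} (X : Fin n → Ω → ℤ) (ω : Ω) : ℤ := ∑ i, X i ω

/-- `X₁ + ⋯ + Xₙ + U₁ + ⋯ + Uₙ`. -/
def sumXU {Ω : Type*} {n : ℕ} (X : Fin n → Ω → ℤ) (U : Fin n → Ω → ℝ) (ω : Ω) : ℝ :=
  (sumX X ω : ℝ) + ∑ i, U i ω

/-- `X₁, …, Xₙ` are i.i.d. log-concave integer-valued random variables, `U₁, …, Uₙ` are i.i.d.
uniform on `(0, 1)`, and the two families are independent of each other. -/
structure IsIIDLogConcaveUniform {Ω : Type*} [MeasurableSpace Ω] (μ : Measure Ω) {n : ℕ}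
    (X : Fin n → Ω → ℤ) (U : Fin n → Ω → ℝ) : Prop where
  measurable_X : ∀ i, Measurable (X i)
  measurable_U : ∀ i, Measurable (U i)
  iIndep_X : iIndepFun X μ
  identDistrib_X : ∀ i j, IdentDistrib (X i) (X j) μ μ
  logConcave_X : ∀ i, IsLogConcave (pmfZ μ (X i))
  iIndep_U : iIndepFun U μ
  uniform_U : ∀ i, pdf.IsUniform (U i) (Set.Ioo (0 : ℝ) 1) μ volume
  indep_X_U : IndepFun (fun ω i => X i ω) (fun ω i => U i ω) μ

/-- `σ ≥ 0` is the common standard deviation of `X₁, …, Xₙ`. -/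
def HasCommonStdDev {Ω : Type*} [MeasurableSpace Ω] (μ : Measure Ω) {n : ℕ}
    (X : Fin n → Ω → ℤ) (σ : ℝ) : Prop :=
  0 ≤ σ ∧ ∀ i, variance (fun ω => (X i ω : ℝ)) μ = σ ^ 2

/-- The explicit error bound. -/
def errorBound (n : ℕ) (σ : ℝ) : ℝ :=
  2 ^ (n + 6) * Real.exp (-(√n * σ) ^ (1 / 5 : ℝ)) * (√n * σ) ^ 3
    + 2 ^ (n + 2) / (σ * √n) * Real.log (2 ^ (n + 2) * σ * √n)
    + Real.log (n * σ ^ 2) / (8 * (n * σ ^ 2))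

end LogConcaveSums

end

/-! Spend one uniform, `U i`, on the lattice: `S + U i` has the step density `p ⌊x⌋`, with `p` the
mass function of the sum, and the entropy integral of this density is exactly `H(S)`. The remaining
uniforms add up to an independent `V` in `[0, n - 1]`, so the full density is the average `E p ⌊x -
V⌋` (`map_add_add_uniform`).

Concavity of `-t log t` gives `H ≤ h`. Conversely, if `0 ≤ Y ≤ G`, the Jensen gap is at most `G - E
Y` (`negMulLog_integral_le`). Taking for `G` the value `p ⌊x⌋` plus the `n - 1` jumps to its left
and integrating gives `h - H ≤ (n - 1) TV(p)` (`integral_negMulLog_smoothed`).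

Convolution does not increase total variation, and for one log-concave summand with maximal mass `M`
it equals `2M`. Geometric decay away from the mode gives `σ² ≤ 180 / M²`, so `M ≤ 14 / σ` and `|h -
H| ≤ 28 (n - 1) / σ`. This lies below the logarithmic term of the explicit bound alone. -/

namespace LogConcaveSums

/-! ### Log-concave sequences: decay, second moment, total variation. -/

namespace IsLogConcave

variable {p : ℤ → ℝ}

theorem comp_neg (hp : IsLogConcave p) : IsLogConcave fun k => p (-k) := by
  refine ⟨fun k => ?_, ⟨fun a ha b hb c hc => ?_⟩⟩
  · have := hp.1 (-k)
    have e1 : -(k - 1) = -k + 1 := by ring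
    have e2 : -(k + 1) = -k - 1 := by ring
    simp only [e1, e2]
    rwa [mul_comm]
  · exact hp.2.out (x := -b) (y := -a) hb ha ⟨by linarith [hc.2], by linarith [hc.1]⟩

theorem comp_add_left (hp : IsLogConcave p) (m : ℤ) : IsLogConcave fun k => p (m + k) := by
  refine ⟨fun k => ?_, ⟨fun a ha b hb c hc => ?_⟩⟩
  · have := hp.1 (m + k)
    rwa [add_sub_assoc, add_assoc] at this
  · exact hp.2.out (x := m + a) (y := m + b) ha hb ⟨by linarith [hc.1], by linarith [hc.2]⟩

/-- The ratio `p (k + 1) / p k` is nonincreasing. Division is avoided by cancelling `p (a + d + 1)`;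
if that vanishes, the absence of gaps makes the left side zero. -/
theorem mul_le_mul_of_adjacent (hp : IsLogConcave p) (h0 : ∀ k, 0 ≤ p k) (a : ℤ) (d : ℕ) :
    p a * p (a + d + 1) ≤ p (a + 1) * p (a + d) := by
  induction d with
  | zero => simp [mul_comm]
  | succ d ih =>
    push_cast
    have hc := hp.1 (a + d + 1)
    have e1 : a + (d : ℤ) + 1 - 1 = a + d := by ring
    rw [e1] at hc
    rw [← add_assoc]
    rcases (h0 (a + d + 1)).eq_or_lt with hz | hpos
    · have : p a * p (a + d + 1 + 1) = 0 := by
        by_contra hne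
        obtain ⟨ha, hb⟩ := mul_ne_zero_iff.1 hne
        exact hp.2.out (x := a) (y := a + d + 1 + 1) ha hb ⟨by omega, by omega⟩ hz.symm
      rw [this]
      exact mul_nonneg (h0 _) (h0 _)
    · refine le_of_mul_le_mul_right ?_ hpos
      calc p a * p (a + d + 1 + 1) * p (a + d + 1)
          = p a * p (a + d + 1) * p (a + d + 1 + 1) := by ring
        _ ≤ p (a + 1) * p (a + d) * p (a + d + 1 + 1) :=
            mul_le_mul_of_nonneg_right ih (h0 _)
        _ = p (a + 1) * (p (a + d) * p (a + d + 1 + 1)) := by ring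
        _ ≤ p (a + 1) * p (a + d + 1) ^ 2 := mul_le_mul_of_nonneg_left hc (h0 _)
        _ = p (a + 1) * p (a + d + 1) * p (a + d + 1) := by ring

theorem mul_le_mul_of_le (hp : IsLogConcave p) (h0 : ∀ k, 0 ≤ p k) (a : ℤ) (i : ℕ) :
    ∀ j : ℕ, i ≤ j → p a * p (a + i + j) ≤ p (a + i) * p (a + j) := by
  induction i with
  | zero => intro j _; simp
  | succ i ih =>
    intro j hij
    have h1 := ih (j + 1) (by omega)
    have h2 := hp.mul_le_mul_of_adjacent h0 (a + i) (j - i)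
    have e1 : a + (i : ℤ) + ((j - i : ℕ) : ℤ) = a + j := by omega
    rw [e1] at h2
    push_cast at h1 ⊢
    rw [show a + ((i : ℤ) + 1) + j = a + i + (j + 1) by ring,
      show a + ((i : ℤ) + 1) = a + i + 1 by ring]
    rw [← add_assoc a (j : ℤ) 1] at h1
    exact h1.trans h2

theorem mul_le_mul (hp : IsLogConcave p) (h0 : ∀ k, 0 ≤ p k) (a : ℤ) (i j : ℕ) :
    p a * p (a + i + j) ≤ p (a + i) * p (a + j) := by
  rcases le_total i j with h | h
  · exact hp.mul_le_mul_of_le h0 a i j h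
  · have := hp.mul_le_mul_of_le h0 a j i h
    rwa [add_right_comm, mul_comm (p (a + i))]

theorem antitone_nat (hp : IsLogConcave p) (h0 : ∀ k, 0 ≤ p k) (hmax : ∀ k, p k ≤ p 0)
    (hpos : 0 < p 0) : Antitone fun r : ℕ => p r := by
  refine antitone_nat_of_succ_le fun r => le_of_mul_le_mul_left ?_ hpos
  have h1 := hp.mul_le_mul h0 0 1 r
  have h2 : p 1 * p r ≤ p 0 * p r := mul_le_mul_of_nonneg_right (hmax 1) (h0 _)
  simp only [zero_add, Nat.cast_one] at h1
  rw [Nat.cast_succ, add_comm]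
  exact h1.trans h2

end IsLogConcave

/-- Shifting the sum `A` by `L` makes it bound itself: `A ≤ L² + (3/4 A + 3/2 L²)`, hence `A ≤ 10
L²`. Partial sums keep `A` finite without assuming convergence. -/
theorem sum_sq_mul_le_of_halving {q : ℕ → ℝ} (h0 : ∀ r, 0 ≤ q r) {L : ℕ}
    (hL : ∀ r, q (r + L) ≤ q r / 2) (hs : ∀ N, ∑ r ∈ Finset.range N, q r ≤ 1) (N : ℕ) :
    ∑ r ∈ Finset.range N, (r : ℝ) ^ 2 * q r ≤ 10 * (L : ℝ) ^ 2 := by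
  have hsplit : ∑ r ∈ Finset.range N, (r : ℝ) ^ 2 * q r ≤
      ∑ r ∈ Finset.range L, (r : ℝ) ^ 2 * q r
        + ∑ r ∈ Finset.range N, ((r + L : ℕ) : ℝ) ^ 2 * q (r + L) := by
    have : ∑ r ∈ Finset.range N, (r : ℝ) ^ 2 * q r ≤ ∑ r ∈ Finset.range (L + N), (r : ℝ) ^ 2 * q r :=
      Finset.sum_le_sum_of_subset_of_nonneg (by intro x; simp; omega)
        fun i _ _ => mul_nonneg (sq_nonneg _) (h0 i)
    rw [Finset.sum_range_add] at this
    simpa only [add_comm L] using this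
  have hfirst : ∑ r ∈ Finset.range L, (r : ℝ) ^ 2 * q r ≤ (L : ℝ) ^ 2 := by
    calc ∑ r ∈ Finset.range L, (r : ℝ) ^ 2 * q r ≤ ∑ r ∈ Finset.range L, (L : ℝ) ^ 2 * q r := by
          refine Finset.sum_le_sum fun r hr => mul_le_mul_of_nonneg_right ?_ (h0 r)
          have : (r : ℝ) ≤ L := by exact_mod_cast (Finset.mem_range.1 hr).le
          gcongr
      _ = (L : ℝ) ^ 2 * ∑ r ∈ Finset.range L, q r := by rw [Finset.mul_sum]
      _ ≤ (L : ℝ) ^ 2 * 1 := mul_le_mul_of_nonneg_left (hs L) (sq_nonneg _)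
      _ = (L : ℝ) ^ 2 := mul_one _
  have hsecond : ∑ r ∈ Finset.range N, ((r + L : ℕ) : ℝ) ^ 2 * q (r + L) ≤
      3 / 4 * ∑ r ∈ Finset.range N, (r : ℝ) ^ 2 * q r + 3 / 2 * (L : ℝ) ^ 2 := by
    calc ∑ r ∈ Finset.range N, ((r + L : ℕ) : ℝ) ^ 2 * q (r + L)
        ≤ ∑ r ∈ Finset.range N,
            (3 / 4 * ((r : ℝ) ^ 2 * q r) + 3 / 2 * (L : ℝ) ^ 2 * q r) := by
          refine Finset.sum_le_sum fun r _ => ?_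
          have h1 : ((r + L : ℕ) : ℝ) ^ 2 * q (r + L) ≤ ((r + L : ℕ) : ℝ) ^ 2 * (q r / 2) :=
            mul_le_mul_of_nonneg_left (hL r) (sq_nonneg _)
          -- The weighting `2rL ≤ r²/2 + 2L²` leaves a coefficient below `1` on `r²` after halving.
          have h2 : ((r + L : ℕ) : ℝ) ^ 2 ≤ 3 / 2 * (r : ℝ) ^ 2 + 3 * (L : ℝ) ^ 2 := by
            push_cast
            nlinarith [sq_nonneg ((r : ℝ) - 2 * L)]
          have h3 := mul_le_mul_of_nonneg_right h2 (div_nonneg (h0 r) zero_le_two)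
          linarith
      _ = 3 / 4 * ∑ r ∈ Finset.range N, (r : ℝ) ^ 2 * q r
            + 3 / 2 * (L : ℝ) ^ 2 * ∑ r ∈ Finset.range N, q r := by
          rw [Finset.sum_add_distrib, Finset.mul_sum, Finset.mul_sum]
      _ ≤ _ := by
          have := mul_le_mul_of_nonneg_left (hs N) (by positivity : 0 ≤ 3 / 2 * (L : ℝ) ^ 2)
          linarith
  linarith

/-- Monotonicity gives `L * q L ≤ 1`, so any `L ≥ 2 / q 0` works; rounding up costs at most `1 ≤ 1 /
q 0`. -/
theorem exists_halving_step {q : ℕ → ℝ} (hq : Antitone q) (h0 : 0 < q 0) (h1 : q 0 ≤ 1)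
    (hs : ∀ N, ∑ r ∈ Finset.range N, q r ≤ 1) :
    ∃ L : ℕ, (L : ℝ) ≤ 3 / q 0 ∧ q L ≤ q 0 / 2 := by
  refine ⟨⌈2 / q 0⌉₊, ?_, ?_⟩
  · have h2 := (Nat.ceil_lt_add_one (by positivity : 0 ≤ 2 / q 0)).le
    have h3 : 1 ≤ 1 / q 0 := by rwa [le_div_iff₀ h0, one_mul]
    calc (⌈2 / q 0⌉₊ : ℝ) ≤ 2 / q 0 + 1 := h2
      _ ≤ 2 / q 0 + 1 / q 0 := by linarith
      _ = 3 / q 0 := by ring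
  · set L := ⌈2 / q 0⌉₊
    have hL : 2 / q 0 ≤ L := Nat.le_ceil _
    have hLpos : 0 < (L : ℝ) := lt_of_lt_of_le (by positivity) hL
    have h2 : (L : ℝ) * q L ≤ 1 := by
      refine le_trans ?_ (hs L)
      calc (L : ℝ) * q L = ∑ r ∈ Finset.range L, q L := by simp
        _ ≤ _ := Finset.sum_le_sum fun r hr => hq (Finset.mem_range.1 hr).le
    rw [div_le_iff₀ h0] at hL
    have h3 : (L : ℝ) * q L ≤ L * (q 0 / 2) := by linarith
    exact le_of_mul_le_mul_left h3 hLpos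

namespace IsLogConcave

variable {p : ℤ → ℝ}

theorem sum_nat_sq_mul_le (hp : IsLogConcave p) (h0 : ∀ k, 0 ≤ p k) (hs : HasSum p 1)
    (hmax : ∀ k, p k ≤ p 0) (hpos : 0 < p 0) (N : ℕ) :
    ∑ r ∈ Finset.range N, (r : ℝ) ^ 2 * p r ≤ 90 / p 0 ^ 2 := by
  have hanti := hp.antitone_nat h0 hmax hpos
  have hsum : ∀ N, ∑ r ∈ Finset.range N, p (r : ℕ) ≤ 1 := fun N => by
    have := sum_le_hasSum ((Finset.range N).map Nat.castEmbedding) (fun k _ => h0 k) hs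
    simpa using this
  obtain ⟨L, hL, hhalf⟩ := exists_halving_step hanti (by simpa using hpos)
    (by simpa using sum_le_hasSum {0} (fun k _ => h0 k) hs) hsum
  simp only [Nat.cast_zero] at hL hhalf
  -- Log-concavity carries a halving at the mode to every point: `p 0 * p (r + L) ≤ p r * p L`.
  have hstep : ∀ r : ℕ, p ((r + L : ℕ) : ℤ) ≤ p r / 2 := fun r => by
    have h1 := hp.mul_le_mul h0 0 r L
    simp only [zero_add] at h1
    have h2 : p r * p L ≤ p r * (p 0 / 2) := mul_le_mul_of_nonneg_left hhalf (h0 _)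
    refine le_of_mul_le_mul_left ?_ hpos
    push_cast
    linarith
  calc ∑ r ∈ Finset.range N, (r : ℝ) ^ 2 * p r ≤ 10 * (L : ℝ) ^ 2 :=
        sum_sq_mul_le_of_halving (q := fun r : ℕ => p r) (fun r => h0 r) hstep hsum N
    _ ≤ 10 * (3 / p 0) ^ 2 := by gcongr
    _ = 90 / p 0 ^ 2 := by ring

theorem exists_mode (h0 : ∀ k, 0 ≤ p k) (hs : HasSum p 1) :
    ∃ m, 0 < p m ∧ ∀ k, p k ≤ p m := by
  obtain ⟨k₀, hk₀⟩ : ∃ k, 0 < p k := by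
    by_contra! h
    have : p = fun _ => 0 := funext fun k => le_antisymm (h k) (h0 k)
    rw [this] at hs
    exact zero_ne_one (hasSum_zero.unique hs)
  -- Summability forces decay at infinity, so the maximum is sought in a finite set.
  have hfin : {k | p k₀ ≤ p k}.Finite := by
    have := hs.summable.tendsto_cofinite_zero.eventually (gt_mem_nhds hk₀)
    simpa only [Filter.eventually_cofinite, not_lt] using this
  obtain ⟨m, hm, hmax⟩ := hfin.exists_maximalFor p _ ⟨k₀, le_refl (p k₀)⟩
  refine ⟨m, hk₀.trans_le hm, fun k => ?_⟩
  by_contra! h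
  exact absurd (hmax (show p k₀ ≤ p k from hm.trans h.le) h.le) (not_le.2 h)

/-- A log-concave probability mass function has a finite second moment about its mode, controlled
by the maximal value. -/
theorem hasSum_sq_mul (hp : IsLogConcave p) (h0 : ∀ k, 0 ≤ p k) (hs : HasSum p 1) {m : ℤ}
    (hpos : 0 < p m) (hmax : ∀ k, p k ≤ p m) :
    ∃ v ≤ 180 / p m ^ 2, HasSum (fun k : ℤ => ((k : ℝ) - m) ^ 2 * p k) v := by
  have hright := (hp.comp_add_left m)
  have hleft := hright.comp_neg
  have hsr : HasSum (fun k => p (m + k)) 1 := (Equiv.addLeft m).hasSum_iff.2 hs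
  have hsl : HasSum (fun k => p (m + -k)) 1 := (Equiv.neg ℤ).hasSum_iff.2 hsr
  have key : ∀ q : ℤ → ℝ, IsLogConcave q → (∀ k, 0 ≤ q k) → HasSum q 1 → (∀ k, q k ≤ q 0) →
      0 < q 0 → ∃ a ≤ 90 / q 0 ^ 2, HasSum (fun r : ℕ => (r : ℝ) ^ 2 * q r) a := by
    intro q hq hq0 hqs hqm hqp
    have hb := hq.sum_nat_sq_mul_le hq0 hqs hqm hqp
    have hn : ∀ r : ℕ, 0 ≤ (r : ℝ) ^ 2 * q r := fun r => mul_nonneg (sq_nonneg _) (hq0 _)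
    exact ⟨_, Real.tsum_le_of_sum_range_le hn hb, (summable_of_sum_range_le hn hb).hasSum⟩
  obtain ⟨a, ha, hsa⟩ := key _ hright (fun k => h0 _) hsr (by simpa using fun k => hmax _)
    (by simpa using hpos)
  obtain ⟨b, hb, hsb⟩ := key _ hleft (fun k => h0 _) hsl (by simpa using fun k => hmax _)
    (by simpa using hpos)
  simp only [add_zero, neg_zero] at ha hb
  -- The subtracted `0` is the term at the mode, which both half-line sums contain.
  have hall : HasSum (fun k : ℤ => (k : ℝ) ^ 2 * p (m + k)) (a + b - 0) := by
    have := HasSum.of_nat_of_neg (f := fun k : ℤ => (k : ℝ) ^ 2 * p (m + k)) (by simpa using hsa)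
      (by simpa using hsb)
    simpa using this
  refine ⟨a + b - 0, ?_, ?_⟩
  · have : 180 / p m ^ 2 = 90 / p m ^ 2 + 90 / p m ^ 2 := by ring
    linarith
  · rw [← (Equiv.addLeft m).hasSum_iff]
    convert hall using 2
    simp

/-- The total variation of a log-concave probability mass function is twice its maximal value. -/
theorem hasSum_abs_sub (hp : IsLogConcave p) (h0 : ∀ k, 0 ≤ p k) (hs : HasSum p 1) {m : ℤ}
    (hpos : 0 < p m) (hmax : ∀ k, p k ≤ p m) :
    HasSum (fun k : ℤ => |p (k + 1) - p k|) (2 * p m) := by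
  have hright := (hp.comp_add_left m)
  have hleft := hright.comp_neg
  have hsr : HasSum (fun k => p (m + k)) 1 := (Equiv.addLeft m).hasSum_iff.2 hs
  have hsl : HasSum (fun k => p (m + -k)) 1 := (Equiv.neg ℤ).hasSum_iff.2 hsr
  -- On each side of the mode the sequence decreases to `0`, so the variation telescopes to the
  -- maximum.
  have key : ∀ q : ℤ → ℝ, IsLogConcave q → (∀ k, 0 ≤ q k) → HasSum q 1 → (∀ k, q k ≤ q 0) →
      0 < q 0 → HasSum (fun r : ℕ => |q (r + 1) - q r|) (q 0) := by
    intro q hq hq0 hqs hqm hqp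
    have hanti := hq.antitone_nat hq0 hqm hqp
    have hlim : Filter.Tendsto (fun r : ℕ => q r) Filter.atTop (nhds 0) :=
      (hqs.summable.comp_injective Nat.cast_injective).tendsto_atTop_zero
    have habs : ∀ r : ℕ, |q (r + 1) - q r| = q r - q (r + 1) := fun r => by
      have := hanti (Nat.le_succ r)
      simp only [Nat.succ_eq_add_one, Nat.cast_add, Nat.cast_one] at this
      rw [abs_sub_comm, abs_of_nonneg (by linarith)]
    rw [hasSum_iff_tendsto_nat_of_nonneg fun r => abs_nonneg _]
    have : ∀ N : ℕ, ∑ r ∈ Finset.range N, |q (r + 1) - q r| = q 0 - q N := fun N => by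
      rw [Finset.sum_congr rfl fun r _ => habs r]
      simpa using Finset.sum_range_sub' (fun r : ℕ => q r) N
    simp only [this]
    simpa using hlim.const_sub (q 0)
  have ha := key _ hright (fun k => h0 _) hsr (by simpa using fun k => hmax _)
    (by simpa using hpos)
  have hb := key _ hleft (fun k => h0 _) hsl (by simpa using fun k => hmax _)
    (by simpa using hpos)
  simp only [add_zero, neg_zero] at ha hb
  rw [← (Equiv.addLeft m).hasSum_iff, two_mul]
  refine HasSum.of_nat_of_neg_add_one ?_ ?_
  · convert ha using 2
    simp [add_assoc]
  · convert hb using 2 with r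
    rw [abs_sub_comm]
    simp only [Function.comp, Equiv.coe_addLeft]
    congr 3
    ring

end IsLogConcave

/-! ### Step functions on the line and averages of translates. -/

theorem integrable_int_iff {κ : Measure ℤ} (hκ : ∀ k, κ {k} ≠ ⊤) {g : ℤ → ℝ} :
    Integrable g κ ↔ Summable fun k => κ.real {k} * |g k| := by
  rw [← Measure.sum_smul_dirac κ, integrable_sum_dirac_iff hκ]
  simp [Measure.sum_smul_dirac, measureReal_def]

theorem map_floor_volume : (volume : Measure ℝ).map (Int.floor : ℝ → ℤ) = Measure.count := by
  refine Measure.ext_of_singleton fun k => ?_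
  rw [Measure.map_apply Int.measurable_floor (measurableSet_singleton k),
    Int.preimage_floor_singleton]
  simp

theorem integrable_comp_floor {g : ℤ → ℝ} (hg : Summable g) :
    Integrable fun x : ℝ => g ⌊x⌋ := by
  have : Integrable g (Measure.map (Int.floor : ℝ → ℤ) volume) := by
    rw [map_floor_volume, integrable_int_iff (by simp)]
    simpa [measureReal_def] using hg.abs
  exact this.comp_measurable Int.measurable_floor

theorem integral_comp_floor {g : ℤ → ℝ} (hg : Summable g) :
    ∫ x : ℝ, g ⌊x⌋ = ∑' k, g k := by
  have : Integrable g (Measure.count : Measure ℤ) := by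
    rw [integrable_int_iff (by simp)]
    simpa [measureReal_def] using hg.abs
  rw [← integral_map (φ := (Int.floor : ℝ → ℤ)) Int.measurable_floor.aemeasurable
    (by fun_prop), map_floor_volume, integral_countable this]
  simp [measureReal_def]

section Translation

variable {ν : Measure ℝ} [IsProbabilityMeasure ν] {φ : ℝ → ℝ}

theorem integrable_translate_prod (hφ : Integrable φ) :
    Integrable (fun z : ℝ × ℝ => φ (z.2 - z.1)) (ν.prod volume) := by
  have h2 := measurePreserving_prod_neg_add ν (volume : Measure ℝ)
  have := h2.integrable_comp_of_integrable (hφ.comp_snd ν)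
  refine this.congr (Filter.Eventually.of_forall fun z => ?_)
  simp [Function.comp, neg_add_eq_sub]

theorem integrable_integral_translate (hφ : Integrable φ) :
    Integrable fun x => ∫ v, φ (x - v) ∂ν :=
  (integrable_translate_prod hφ).integral_prod_right

theorem integral_integral_translate (hφ : Integrable φ) :
    ∫ x, ∫ v, φ (x - v) ∂ν = ∫ x, φ x := by
  rw [← integral_integral_swap (f := fun v x => φ (x - v)) (integrable_translate_prod hφ)]
  simp [integral_sub_right_eq_self]

/-- Tonelli and translation invariance, tested against nonnegative functions; `ν` itself needs no
density. -/
theorem conv_withDensity {ℓ : ℝ → ENNReal} (hℓ : Measurable ℓ)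
    [SFinite ((volume : Measure ℝ).withDensity ℓ)] :
    ν.conv (volume.withDensity ℓ) = volume.withDensity fun x => ∫⁻ v, ℓ (x - v) ∂ν := by
  refine Measure.ext_of_lintegral _ fun g hg => ?_
  have hm : Measurable fun x => ∫⁻ v, ℓ (x - v) ∂ν :=
    Measurable.lintegral_prod_right' (f := fun z : ℝ × ℝ => ℓ (z.1 - z.2)) (by fun_prop)
  rw [Measure.lintegral_conv hg, lintegral_withDensity_eq_lintegral_mul _ hm hg]
  calc ∫⁻ v, ∫⁻ y, g (v + y) ∂volume.withDensity ℓ ∂ν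
      = ∫⁻ v, ∫⁻ x, ℓ (x - v) * g x ∂volume ∂ν := by
        refine lintegral_congr fun v => ?_
        rw [lintegral_withDensity_eq_lintegral_mul _ hℓ (by fun_prop),
          ← lintegral_sub_right_eq_self _ v]
        simp
    _ = ∫⁻ x, ∫⁻ v, ℓ (x - v) * g x ∂ν ∂volume := lintegral_lintegral_swap (by fun_prop)
    _ = _ := by
        refine lintegral_congr fun x => ?_
        rw [lintegral_mul_const _ (by fun_prop)]
        rfl

end Translation

/-! ### Jensen's inequality for `-t log t` and its reverse. -/

section JensenGap

/-- This is `log t ≤ t - 1` at `t = m / y`, multiplied by `y`. -/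
theorem negMulLog_le_tangent {y m : ℝ} (hy : 0 ≤ y) (hm : 0 < m) :
    Real.negMulLog y ≤ -(y * Real.log m) + (m - y) := by
  rcases hy.eq_or_lt with rfl | hy
  · simp [hm.le]
  · have h := Real.log_le_sub_one_of_pos (div_pos hm hy)
    rw [Real.log_div hm.ne' hy.ne'] at h
    have := mul_le_mul_of_nonneg_left h hy.le
    rw [mul_sub, mul_sub, mul_div_cancel₀ _ hy.ne'] at this
    rw [Real.negMulLog]
    linarith

/-- Here `log t ≤ t - 1` is used at `t = y / m ≤ G / m`. The minorant is linear in `y`, so it can be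
integrated knowing only the mean. -/
theorem le_negMulLog_of_le {y m G : ℝ} (hy : 0 ≤ y) (hm : 0 < m) (hG : y ≤ G) :
    -(y * Real.log m) - y * (G / m - 1) ≤ Real.negMulLog y := by
  rcases hy.eq_or_lt with rfl | hy
  · simp
  · have h := Real.log_le_sub_one_of_pos (div_pos hy hm)
    rw [Real.log_div hy.ne' hm.ne'] at h
    have h2 : y / m ≤ G / m := by gcongr
    have := mul_le_mul_of_nonneg_left (h.trans (sub_le_sub_right h2 1)) hy.le
    rw [mul_sub] at this
    rw [Real.negMulLog]
    linarith

variable {α : Type*} [MeasurableSpace α] {ν : Measure α} [IsProbabilityMeasure ν] {Y : α → ℝ}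

theorem integrable_of_mem_Icc (hY : Measurable Y) (h : ∀ a, Y a ∈ Set.Icc (0 : ℝ) 1) :
    Integrable Y ν :=
  Integrable.of_bound hY.aestronglyMeasurable 1
    (Filter.Eventually.of_forall fun a => by
      rw [Real.norm_of_nonneg (h a).1]; exact (h a).2)

theorem negMulLog_le_one {y : ℝ} (h : y ∈ Set.Icc (0 : ℝ) 1) : Real.negMulLog y ≤ 1 := by
  have := negMulLog_le_tangent h.1 one_pos
  simp only [Real.log_one] at this
  linarith [h.1]

theorem integrable_negMulLog_of_mem_Icc (hY : Measurable Y) (h : ∀ a, Y a ∈ Set.Icc (0 : ℝ) 1) :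
    Integrable (fun a => Real.negMulLog (Y a)) ν :=
  integrable_of_mem_Icc (Real.continuous_negMulLog.measurable.comp hY) fun a =>
    ⟨Real.negMulLog_nonneg (h a).1 (h a).2, negMulLog_le_one (h a)⟩

theorem integral_negMulLog_le (hY : Measurable Y) (h : ∀ a, Y a ∈ Set.Icc (0 : ℝ) 1) :
    ∫ a, Real.negMulLog (Y a) ∂ν ≤ Real.negMulLog (∫ a, Y a ∂ν) :=
  Real.concaveOn_negMulLog.le_map_integral Real.continuous_negMulLog.continuousOn isClosed_Ici
    (Filter.Eventually.of_forall fun a => (h a).1) (integrable_of_mem_Icc hY h)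
    (integrable_negMulLog_of_mem_Icc hY h)

/-- A reverse Jensen inequality for `x ↦ -x log x`. -/
theorem negMulLog_integral_le (hY : Measurable Y) (h : ∀ a, Y a ∈ Set.Icc (0 : ℝ) 1) {G : ℝ}
    (hG : ∀ᵐ a ∂ν, Y a ≤ G) :
    Real.negMulLog (∫ a, Y a ∂ν) ≤ ∫ a, Real.negMulLog (Y a) ∂ν + (G - ∫ a, Y a ∂ν) := by
  have hi : Integrable Y ν := integrable_of_mem_Icc hY h
  have hm0 : 0 ≤ ∫ a, Y a ∂ν := integral_nonneg fun a => (h a).1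
  have hmG : ∫ a, Y a ∂ν ≤ G := by simpa using integral_mono_ae hi (integrable_const G) hG
  rcases hm0.eq_or_lt with hm | hm
  · rw [← hm] at hmG ⊢
    have : 0 ≤ ∫ a, Real.negMulLog (Y a) ∂ν :=
      integral_nonneg fun a => Real.negMulLog_nonneg (h a).1 (h a).2
    rw [Real.negMulLog_zero]
    linarith
  · set m := ∫ a, Y a ∂ν with hmdef
    have key : ∫ a, (-Real.log m - (G / m - 1)) * Y a ∂ν ≤ ∫ a, Real.negMulLog (Y a) ∂ν := by
      refine integral_mono_ae (hi.const_mul _) (integrable_negMulLog_of_mem_Icc hY h) ?_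
      filter_upwards [hG] with a ha
      have := le_negMulLog_of_le (h a).1 hm ha
      linarith
    rw [integral_const_mul, ← hmdef] at key
    have e : (-Real.log m - (G / m - 1)) * m = -m * Real.log m - (G - m) := by
      field_simp
    rw [e] at key
    rw [Real.negMulLog]
    linarith

end JensenGap

/-! ### Entropy of the smoothed step density. -/

/-- The mixture `x ↦ E p(⌊x - V⌋)` of translates of the step density of `p`. -/
noncomputable def smoothed (p : ℤ → ℝ) (ν : Measure ℝ) (x : ℝ) : ℝ := ∫ v, p ⌊x - v⌋ ∂ν

theorem le_add_sum_abs_sub (p : ℤ → ℝ) (n : ℕ) (k : ℤ) {j : ℕ} (hj : j ≤ n) :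
    p (k - j) ≤ p k + ∑ i ∈ Finset.range n, |p (k - i) - p (k - i - 1)| := by
  have h1 : p (k - j) ≤ p k + ∑ i ∈ Finset.range j, |p (k - i) - p (k - i - 1)| := by
    clear hj
    induction j with
    | zero => simp
    | succ j ih =>
      rw [Finset.sum_range_succ]
      have := neg_abs_le (p (k - j) - p (k - j - 1))
      push_cast
      rw [← sub_sub]
      linarith
  have h2 : ∑ i ∈ Finset.range j, |p (k - i) - p (k - i - 1)| ≤
      ∑ i ∈ Finset.range n, |p (k - i) - p (k - i - 1)| :=
    Finset.sum_le_sum_of_subset_of_nonneg (Finset.range_subset_range.2 hj) fun _ _ _ => abs_nonneg _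
  linarith

/-- The cell of `x - v` is at most `n` steps left of that of `x`. The bound is independent of `v`,
as the reverse Jensen inequality requires of `G`. -/
theorem apply_floor_sub_le (p : ℤ → ℝ) (n : ℕ) (x : ℝ) {v : ℝ} (hv : v ∈ Set.Icc (0 : ℝ) n) :
    p ⌊x - v⌋ ≤ p ⌊x⌋ + ∑ i ∈ Finset.range n, |p (⌊x⌋ - i) - p (⌊x⌋ - i - 1)| := by
  have h1 : ⌊x - v⌋ ≤ ⌊x⌋ := Int.floor_le_floor (by linarith [hv.1])
  have h2 : ⌊x⌋ - n ≤ ⌊x - v⌋ := by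
    rw [Int.le_floor]
    push_cast
    linarith [hv.2, Int.floor_le x]
  have := le_add_sum_abs_sub p n ⌊x⌋ (j := (⌊x⌋ - ⌊x - v⌋).toNat) (by omega)
  rwa [show ⌊x⌋ - ((⌊x⌋ - ⌊x - v⌋).toNat : ℤ) = ⌊x - v⌋ by omega] at this

section Smoothed

variable {p : ℤ → ℝ} {ν : Measure ℝ} [IsProbabilityMeasure ν]

theorem measurable_apply_floor_sub (p : ℤ → ℝ) (x : ℝ) : Measurable fun v : ℝ => p ⌊x - v⌋ :=
  (measurable_of_countable p).comp (Int.measurable_floor.comp (measurable_const.sub measurable_id))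

/-- The differential entropy of a mixture of translates of the step density of `p` exceeds the
Shannon entropy of `p` by at most a multiple of the total variation of `p`. -/
theorem integral_negMulLog_smoothed (h0 : ∀ k, 0 ≤ p k) (hs : HasSum p 1)
    (hF : Summable fun k => Real.negMulLog (p k)) {n : ℕ}
    (hν : ∀ᵐ v ∂ν, v ∈ Set.Icc (0 : ℝ) n) (hT : Summable fun k : ℤ => |p (k + 1) - p k|) :
    Integrable (fun x => Real.negMulLog (smoothed p ν x)) ∧
      ∑' k, Real.negMulLog (p k) ≤ ∫ x, Real.negMulLog (smoothed p ν x) ∧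
      ∫ x, Real.negMulLog (smoothed p ν x) ≤
        ∑' k, Real.negMulLog (p k) + n * ∑' k, |p (k + 1) - p k| := by
  have h01 : ∀ k, p k ∈ Set.Icc (0 : ℝ) 1 := fun k =>
    ⟨h0 k, by simpa using sum_le_hasSum {k} (fun k _ => h0 k) hs⟩
  set g : ℤ → ℝ := fun k => ∑ i ∈ Finset.range n, |p (k - i) - p (k - i - 1)|
  have hterm : ∀ i : ℕ, HasSum (fun k : ℤ => |p (k - i) - p (k - i - 1)|)
      (∑' k, |p (k + 1) - p k|) := fun i => by
    rw [← (Equiv.addRight ((i : ℤ) + 1)).hasSum_iff]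
    convert hT.hasSum using 2 with k
    simp only [Function.comp, Equiv.coe_addRight]
    congr 3 <;> ring
  have hg : HasSum g (n * ∑' k, |p (k + 1) - p k|) := by
    have := hasSum_sum (s := Finset.range n) fun i _ => hterm i
    simpa using this
  have hP := integrable_comp_floor hs.summable
  have hFP := integrable_comp_floor hF
  have hG := integrable_comp_floor (hs.add hg).summable
  have lower : ∀ x, ∫ v, Real.negMulLog (p ⌊x - v⌋) ∂ν ≤ Real.negMulLog (smoothed p ν x) :=
    fun x => integral_negMulLog_le (measurable_apply_floor_sub p x) fun v => h01 _
  have upper : ∀ x, Real.negMulLog (smoothed p ν x) ≤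
      ∫ v, Real.negMulLog (p ⌊x - v⌋) ∂ν + (p ⌊x⌋ + g ⌊x⌋ - smoothed p ν x) :=
    fun x => negMulLog_integral_le (measurable_apply_floor_sub p x) (fun v => h01 _)
      (hν.mono fun v hv => apply_floor_sub_le p n x hv)
  have hIF : Integrable fun x => ∫ v, Real.negMulLog (p ⌊x - v⌋) ∂ν :=
    integrable_integral_translate hFP
  have hIP : Integrable (smoothed p ν) := integrable_integral_translate hP
  have hIU : Integrable fun x => ∫ v, Real.negMulLog (p ⌊x - v⌋) ∂ν
      + (p ⌊x⌋ + g ⌊x⌋ - smoothed p ν x) := hIF.add (hG.sub hIP)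
  have hint : Integrable fun x => Real.negMulLog (smoothed p ν x) :=
    integrable_of_le_of_le
      (Real.continuous_negMulLog.comp_aestronglyMeasurable hIP.aestronglyMeasurable)
      (Filter.Eventually.of_forall lower) (Filter.Eventually.of_forall upper) hIF hIU
  have eF : ∫ x, ∫ v, Real.negMulLog (p ⌊x - v⌋) ∂ν = ∑' k, Real.negMulLog (p k) := by
    rw [← integral_comp_floor hF]
    exact integral_integral_translate hFP
  have eP : ∫ x, smoothed p ν x = 1 := by
    rw [← hs.tsum_eq, ← integral_comp_floor hs.summable]
    exact integral_integral_translate hP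
  refine ⟨hint, ?_, ?_⟩
  · rw [← eF]
    exact integral_mono hIF hint lower
  · refine (integral_mono hint hIU upper).trans (le_of_eq ?_)
    -- Both `p ⌊x⌋` and the smoothed density have mass `1`; only the jumps survive.
    have e1 : ∫ x, (p ⌊x⌋ + g ⌊x⌋ - smoothed p ν x) = n * ∑' k, |p (k + 1) - p k| := by
      rw [integral_sub hG hIP, eP, integral_comp_floor (hs.add hg).summable, (hs.add hg).tsum_eq]
      ring
    rw [← eF, ← e1]
    exact integral_add hIF (hG.sub hIP)

end Smoothed

/-! ### Integer-valued random variables and their mass functions. -/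

section IntegerValued

variable {Ω : Type*} [MeasurableSpace Ω] {μ : Measure Ω} {X R : Ω → ℤ}

theorem pmfZ_eq_map (hX : Measurable X) (k : ℤ) : pmfZ μ X k = (μ.map X).real {k} := by
  rw [pmfZ, map_measureReal_apply hX (measurableSet_singleton k)]

theorem pmfZ_nonneg (k : ℤ) : 0 ≤ pmfZ μ X k := measureReal_nonneg

variable [IsProbabilityMeasure μ]

theorem integrable_comp_iff (hX : Measurable X) (g : ℤ → ℝ) :
    Integrable (fun ω => g (X ω)) μ ↔ Summable fun k => |g k| * pmfZ μ X k := by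
  rw [← Function.comp_def, ← integrable_map_measure (by fun_prop) hX.aemeasurable,
    integrable_int_iff (fun k => measure_ne_top _ _)]
  simp only [pmfZ_eq_map hX, mul_comm]

theorem integral_comp_eq_tsum (hX : Measurable X) {g : ℤ → ℝ}
    (hg : Summable fun k => |g k| * pmfZ μ X k) :
    ∫ ω, g (X ω) ∂μ = ∑' k, g k * pmfZ μ X k := by
  have hi := (integrable_comp_iff hX g).2 hg
  rw [← Function.comp_def, ← integrable_map_measure (by fun_prop) hX.aemeasurable] at hi
  rw [← integral_map hX.aemeasurable (by fun_prop), integral_countable hi]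
  simp only [pmfZ_eq_map hX, smul_eq_mul, mul_comm]

theorem hasSum_pmfZ (hX : Measurable X) : HasSum (pmfZ μ X) 1 := by
  have h1 : Summable fun k => |(1 : ℝ)| * pmfZ μ X k :=
    (integrable_comp_iff hX fun _ => 1).1 (integrable_const _)
  have h2 := integral_comp_eq_tsum hX h1
  simp only [integral_const, probReal_univ, smul_eq_mul, one_mul, abs_one] at h1 h2
  rw [h2]
  exact h1.hasSum

theorem memLp_two_of_summable (hX : Measurable X) {m : ℤ}
    (h : Summable fun k : ℤ => ((k : ℝ) - m) ^ 2 * pmfZ μ X k) :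
    MemLp (fun ω => (X ω : ℝ)) 2 μ := by
  have h1 : MemLp (fun ω => (X ω : ℝ) - m) 2 μ := by
    rw [memLp_two_iff_integrable_sq (by fun_prop)]
    exact (integrable_comp_iff hX fun k => ((k : ℝ) - m) ^ 2).2 (by simpa using h)
  convert h1.add (memLp_const (m : ℝ)) using 1
  ext ω
  simp

theorem variance_le_tsum (hX : Measurable X) {m : ℤ}
    (h : Summable fun k : ℤ => ((k : ℝ) - m) ^ 2 * pmfZ μ X k) :
    variance (fun ω => (X ω : ℝ)) μ ≤ ∑' k : ℤ, ((k : ℝ) - m) ^ 2 * pmfZ μ X k := by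
  rw [← integral_comp_eq_tsum hX (g := fun k => ((k : ℝ) - m) ^ 2) (by simpa using h),
    ← variance_sub_const (c := (m : ℝ)) (by fun_prop)]
  exact variance_le_expectation_sq (by fun_prop)

/-- The tangent bound at `m = 1 / k²` gives `-p log p ≤ k² p + 1 / k²` for `k ≠ 0`. -/
theorem summable_negMulLog_pmfZ (hX : Measurable X) (h : MemLp (fun ω => (X ω : ℝ)) 2 μ) :
    Summable fun k => Real.negMulLog (pmfZ μ X k) := by
  have h1 := (memLp_two_iff_integrable_sq (by fun_prop)).1 h
  have h2 : Summable fun k : ℤ => (k : ℝ) ^ 2 * pmfZ μ X k := by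
    simpa using (integrable_comp_iff hX fun k => (k : ℝ) ^ 2).1 h1
  have h3 : Summable fun k : ℤ => 1 / (k : ℝ) ^ 2 := Real.summable_one_div_int_pow.2 one_lt_two
  refine Summable.of_norm_bounded_eventually (h2.add h3) ?_
  filter_upwards [(Set.finite_singleton (0 : ℤ)).compl_mem_cofinite] with k hk
  have hk0 : (k : ℝ) ≠ 0 := by exact_mod_cast hk
  have hsq : 0 < (k : ℝ) ^ 2 := by positivity
  have hp0 : 0 ≤ pmfZ μ X k := pmfZ_nonneg k
  rw [Real.norm_of_nonneg (Real.negMulLog_nonneg hp0 measureReal_le_one)]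
  have ht := negMulLog_le_tangent hp0 (one_div_pos.2 hsq)
  rw [one_div, Real.log_inv] at ht
  have hl := mul_le_mul_of_nonneg_left (Real.log_le_sub_one_of_pos hsq) hp0
  rw [one_div]
  linarith

theorem pmfZ_add (hX : Measurable X) (hR : Measurable R) (h : IndepFun R X μ) (k : ℤ) :
    pmfZ μ (R + X) k = ∫ r, pmfZ μ X (k - r) ∂μ.map R := by
  have := Measure.isProbabilityMeasure_map (μ := μ) hX.aemeasurable
  have := Measure.isProbabilityMeasure_map (μ := μ) hR.aemeasurable
  have hm : MeasurableSet {z : ℤ × ℤ | z.1 + z.2 = k} := MeasurableSet.of_discrete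
  have e : μ ((R + X) ⁻¹' {k}) = ∫⁻ r, μ.map X {k - r} ∂μ.map R := by
    have : (R + X) ⁻¹' {k} = (fun ω => (R ω, X ω)) ⁻¹' {z : ℤ × ℤ | z.1 + z.2 = k} := by
      ext ω; simp
    rw [this, ← Measure.map_apply (hR.prodMk hX) hm,
      (indepFun_iff_map_prod_eq_prod_map_map hR.aemeasurable hX.aemeasurable).1 h,
      Measure.prod_apply hm]
    refine lintegral_congr fun r => congrArg _ ?_
    ext x
    simp only [Set.mem_preimage, Set.mem_ofPred_eq, Set.mem_singleton_iff]
    omega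
  rw [pmfZ, measureReal_def, e, ← integral_toReal (measurable_of_countable _).aemeasurable
    (Filter.Eventually.of_forall fun r => measure_lt_top _ _)]
  simp only [pmfZ_eq_map hX, measureReal_def]

/-- Adding an independent summand does not increase the total variation. -/
theorem summable_abs_sub_pmfZ_add (hX : Measurable X) (hR : Measurable R) (h : IndepFun R X μ)
    {T : ℝ} (hT : HasSum (fun k => |pmfZ μ X (k + 1) - pmfZ μ X k|) T) :
    Summable (fun k => |pmfZ μ (R + X) (k + 1) - pmfZ μ (R + X) k|) ∧
      ∑' k, |pmfZ μ (R + X) (k + 1) - pmfZ μ (R + X) k| ≤ T := by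
  have := Measure.isProbabilityMeasure_map (μ := μ) hR.aemeasurable
  have hi : ∀ k, Integrable (fun r => pmfZ μ X (k - r)) (μ.map R) := fun k =>
    integrable_of_mem_Icc (measurable_of_countable _) fun r => ⟨pmfZ_nonneg _, measureReal_le_one⟩
  have hd : ∀ k, Integrable (fun r => |pmfZ μ X (k + 1 - r) - pmfZ μ X (k - r)|) (μ.map R) :=
    fun k => ((hi _).sub (hi _)).abs
  have hfin : ∀ s : Finset ℤ, ∑ k ∈ s, |pmfZ μ (R + X) (k + 1) - pmfZ μ (R + X) k| ≤ T := by
    intro s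
    calc ∑ k ∈ s, |pmfZ μ (R + X) (k + 1) - pmfZ μ (R + X) k|
        ≤ ∑ k ∈ s, ∫ r, |pmfZ μ X (k + 1 - r) - pmfZ μ X (k - r)| ∂μ.map R := by
          refine Finset.sum_le_sum fun k _ => ?_
          rw [pmfZ_add hX hR h, pmfZ_add hX hR h, ← integral_sub (hi _) (hi _)]
          exact abs_integral_le_integral_abs
      _ = ∫ r, ∑ k ∈ s, |pmfZ μ X (k + 1 - r) - pmfZ μ X (k - r)| ∂μ.map R :=
          (integral_finsetSum _ fun k _ => hd k).symm
      _ ≤ ∫ r, T ∂μ.map R := by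
          refine integral_mono (integrable_finsetSum _ fun k _ => hd k) (integrable_const _)
            fun r => ?_
          have hr := (Equiv.subRight r).hasSum_iff.2 hT
          refine le_trans (le_of_eq ?_) (sum_le_hasSum s (fun k _ => abs_nonneg _) hr)
          refine Finset.sum_congr rfl fun k _ => ?_
          simp only [Equiv.subRight_apply]
          rw [sub_add_eq_add_sub]
      _ = T := by simp
  exact ⟨summable_of_sum_le (fun k => abs_nonneg _) hfin,
    Real.tsum_le_of_sum_le (fun k => abs_nonneg _) hfin⟩

theorem exists_log_concave_bound (hX : Measurable X) (h : IsLogConcave (pmfZ μ X)) :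
    ∃ M : ℝ, 0 < M ∧ HasSum (fun k => |pmfZ μ X (k + 1) - pmfZ μ X k|) (2 * M) ∧
      MemLp (fun ω => (X ω : ℝ)) 2 μ ∧ variance (fun ω => (X ω : ℝ)) μ ≤ 180 / M ^ 2 := by
  have hs := hasSum_pmfZ (μ := μ) hX
  obtain ⟨m, hpos, hmax⟩ := IsLogConcave.exists_mode pmfZ_nonneg hs
  obtain ⟨v, hv, hsum⟩ := h.hasSum_sq_mul pmfZ_nonneg hs hpos hmax
  refine ⟨pmfZ μ X m, hpos, h.hasSum_abs_sub pmfZ_nonneg hs hpos hmax,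
    memLp_two_of_summable hX hsum.summable, ?_⟩
  refine (variance_le_tsum hX hsum.summable).trans ?_
  rwa [hsum.tsum_eq]

theorem map_add_add_uniform (hX : Measurable X) {V U : Ω → ℝ} (hV : Measurable V)
    (hU : Measurable U) (hunif : pdf.IsUniform U (Set.Ioo (0 : ℝ) 1) μ volume)
    (hXVU : IndepFun X (V + U) μ) (hVU : IndepFun V U μ) :
    μ.map (fun ω => (X ω : ℝ) + (V ω + U ω)) =
      volume.withDensity fun x => ENNReal.ofReal (smoothed (pmfZ μ X) (μ.map V) x) := by
  have hXr : Measurable fun ω => (X ω : ℝ) := by fun_prop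
  have := Measure.isProbabilityMeasure_map (μ := μ) hXr.aemeasurable
  have := Measure.isProbabilityMeasure_map (μ := μ) hV.aemeasurable
  have := Measure.isProbabilityMeasure_map (μ := μ) hU.aemeasurable
  -- The half-open interval makes `x - X ∈ [0, 1)` equivalent to `X = ⌊x⌋` for every `x`.
  have hUmap : μ.map U = volume.withDensity ((Set.Ico (0 : ℝ) 1).indicator 1) := by
    rw [withDensity_indicator_one measurableSet_Ico, hunif, ProbabilityTheory.cond,
      Measure.restrict_congr_set Ioo_ae_eq_Ico]
    simp
  have hm1 : Measurable ((Set.Ico (0 : ℝ) 1).indicator (1 : ℝ → ENNReal)) :=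
    measurable_one.indicator measurableSet_Ico
  have hXU : (μ.map fun ω => (X ω : ℝ)).conv (μ.map U) =
      volume.withDensity fun x : ℝ => ENNReal.ofReal (pmfZ μ X ⌊x⌋) := by
    have : SFinite ((volume : Measure ℝ).withDensity ((Set.Ico (0 : ℝ) 1).indicator 1)) := by
      rw [← hUmap]; infer_instance
    rw [hUmap, conv_withDensity hm1]
    congr 1
    ext1 x
    rw [lintegral_map (by fun_prop) hXr, pmfZ, ofReal_measureReal,
      ← lintegral_indicator_one (hX (measurableSet_singleton _))]
    refine lintegral_congr fun ω => ?_
    simp only [Set.indicator, Set.mem_Ico, Set.mem_preimage, Set.mem_singleton_iff, Pi.one_apply]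
    congr 1
    rw [eq_comm (a := X ω), Int.floor_eq_iff]
    apply propext
    constructor <;> rintro ⟨h1, h2⟩ <;> constructor <;> linarith
  have hsm : Measurable fun x : ℝ => ENNReal.ofReal (pmfZ μ X ⌊x⌋) :=
    ENNReal.measurable_ofReal.comp ((measurable_of_countable (pmfZ μ X)).comp Int.measurable_floor)
  have hsf : SFinite ((volume : Measure ℝ).withDensity fun x => ENNReal.ofReal (pmfZ μ X ⌊x⌋)) := by
    rw [← hXU]; infer_instance
  have e1 : μ.map (fun ω => (X ω : ℝ) + (V ω + U ω)) =
      (μ.map fun ω => (X ω : ℝ)).conv (μ.map (V + U)) :=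
    IndepFun.map_add_eq_map_conv_map (M := ℝ) hXr (hV.add hU)
      (hXVU.comp (φ := fun k : ℤ => (k : ℝ)) (measurable_of_countable _) measurable_id)
  rw [e1, hVU.map_add_eq_map_conv_map hV hU, ← Measure.conv_assoc,
    Measure.conv_comm (μ.map fun ω => (X ω : ℝ)), Measure.conv_assoc, hXU, conv_withDensity hsm]
  congr 1
  ext1 x
  rw [smoothed, ofReal_integral_eq_lintegral_ofReal]
  · exact integrable_of_mem_Icc (measurable_apply_floor_sub _ x)
      fun v => ⟨pmfZ_nonneg _, measureReal_le_one⟩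
  · exact Filter.Eventually.of_forall fun v => pmfZ_nonneg _

end IntegerValued

/-! ### The i.i.d. setting and the `O(1 / σ)` bound. -/

theorem measurable_smoothed (p : ℤ → ℝ) (ν : Measure ℝ) [SFinite ν] :
    Measurable (smoothed p ν) := by
  have : Measurable fun z : ℝ × ℝ => p ⌊z.1 - z.2⌋ :=
    (measurable_of_countable p).comp (Int.measurable_floor.comp (measurable_fst.sub measurable_snd))
  exact (this.stronglyMeasurable.integral_prod_right (ν := ν)).measurable

theorem smoothed_nonneg {p : ℤ → ℝ} (h0 : ∀ k, 0 ≤ p k) (ν : Measure ℝ) (x : ℝ) :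
    0 ≤ smoothed p ν x := integral_nonneg fun _ => h0 _

namespace IsIIDLogConcaveUniform

variable {Ω : Type*} [MeasurableSpace Ω] {μ : Measure Ω} {n : ℕ}
  {X : Fin n → Ω → ℤ} {U : Fin n → Ω → ℝ}

theorem measurable_sumX (h : IsIIDLogConcaveUniform μ X U) : Measurable (sumX X) :=
  Finset.measurable_fun_sum _ fun i _ => h.measurable_X i

theorem measurable_sum_X (h : IsIIDLogConcaveUniform μ X U) (s : Finset (Fin n)) :
    Measurable (∑ j ∈ s, X j) := by
  rw [Finset.sum_fn]
  exact Finset.measurable_fun_sum _ fun i _ => h.measurable_X i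

theorem measurable_sum_U (h : IsIIDLogConcaveUniform μ X U) (s : Finset (Fin n)) :
    Measurable (∑ j ∈ s, U j) := by
  rw [Finset.sum_fn]
  exact Finset.measurable_fun_sum _ fun i _ => h.measurable_U i

theorem measurable_sumXU (h : IsIIDLogConcaveUniform μ X U) : Measurable (sumXU X U) :=
  ((measurable_of_countable (fun k : ℤ => (k : ℝ))).comp h.measurable_sumX).add
    (Finset.measurable_fun_sum _ fun i _ => h.measurable_U i)

theorem ae_mem_Icc (h : IsIIDLogConcaveUniform μ X U) (s : Finset (Fin n)) :
    ∀ᵐ v ∂μ.map (∑ j ∈ s, U j), v ∈ Set.Icc (0 : ℝ) s.card := by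
  have hU : ∀ i, ∀ᵐ ω ∂μ, U i ω ∈ Set.Ioo (0 : ℝ) 1 := fun i => by
    refine ae_of_ae_map (h.measurable_U i).aemeasurable ?_
    rw [h.uniform_U i]
    exact ae_cond_mem measurableSet_Ioo
  refine (ae_map_iff (h.measurable_sum_U s).aemeasurable measurableSet_Icc).2 ?_
  filter_upwards [ae_all_iff.2 hU] with ω hω
  rw [Finset.sum_apply]
  refine ⟨Finset.sum_nonneg fun i _ => (hω i).1.le, ?_⟩
  simpa using Finset.sum_le_sum fun i (_ : i ∈ s) => (hω i).2.le

variable [IsProbabilityMeasure μ]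

theorem memLp_two (h : IsIIDLogConcaveUniform μ X U) (i : Fin n) :
    MemLp (fun ω => (X i ω : ℝ)) 2 μ :=
  (exists_log_concave_bound (h.measurable_X i) (h.logConcave_X i)).choose_spec.2.2.1

theorem summable_negMulLog (h : IsIIDLogConcaveUniform μ X U) :
    Summable fun k => Real.negMulLog (pmfZ μ (sumX X) k) := by
  refine summable_negMulLog_pmfZ h.measurable_sumX ?_
  have := memLp_finsetSum (μ := μ) (p := 2) Finset.univ
    (f := fun i ω => (X i ω : ℝ)) fun i _ => h.memLp_two i
  simpa [sumX] using this

theorem map_sumXU (h : IsIIDLogConcaveUniform μ X U) (i : Fin n) :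
    μ.map (sumXU X U) = volume.withDensity fun x => ENNReal.ofReal
      (smoothed (pmfZ μ (sumX X)) (μ.map (∑ j ∈ Finset.univ.erase i, U j)) x) := by
  have hV : Measurable (∑ j ∈ Finset.univ.erase i, U j) :=
    h.measurable_sum_U _
  have hsum : ∑ j ∈ Finset.univ.erase i, U j + U i = fun ω => ∑ j, U j ω := by
    rw [Finset.sum_erase_add _ _ (Finset.mem_univ i)]
    ext ω
    simp
  have hind : IndepFun (sumX X) (∑ j ∈ Finset.univ.erase i, U j + U i) μ := by
    rw [hsum]
    exact h.indep_X_U.comp (φ := fun x : Fin n → ℤ => ∑ j, x j)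
      (ψ := fun x : Fin n → ℝ => ∑ j, x j) (by fun_prop) (by fun_prop)
  rw [← map_add_add_uniform h.measurable_sumX hV (h.measurable_U i) (h.uniform_U i) hind
    (h.iIndep_U.indepFun_finsetSum_of_notMem h.measurable_U (Finset.notMem_erase i _))]
  congr 1
  ext ω
  have := congrFun hsum ω
  simp only [Pi.add_apply] at this
  rw [this, sumXU]

theorem hasPDF_sumXU (h : IsIIDLogConcaveUniform μ X U) (i : Fin n) :
    HasPDF (sumXU X U) μ volume :=
  hasPDF_of_map_eq_withDensity h.measurable_sumXU.aemeasurable _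
    (ENNReal.measurable_ofReal.comp (measurable_smoothed _ _)).aemeasurable (h.map_sumXU i)

theorem density_ae_eq (h : IsIIDLogConcaveUniform μ X U) (i : Fin n) :
    density μ (sumXU X U) =ᵐ[volume]
      smoothed (pmfZ μ (sumX X)) (μ.map (∑ j ∈ Finset.univ.erase i, U j)) := by
  have := h.hasPDF_sumXU i
  have hpdf := (pdf.eq_of_map_eq_withDensity _
    (ENNReal.measurable_ofReal.comp (measurable_smoothed _ _)).aemeasurable).1 (h.map_sumXU i)
  filter_upwards [hpdf] with x hx
  rw [density, hx]
  exact ENNReal.toReal_ofReal (smoothed_nonneg pmfZ_nonneg _ _)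

/-- The two entropies differ by at most a constant times the maximal value of the probability mass
function of one summand, which is inversely proportional to the standard deviation. -/
theorem entropy_bounds (h : IsIIDLogConcaveUniform μ X U) (i : Fin n) :
    Integrable (fun x : ℝ => Real.negMulLog (density μ (sumXU X U) x)) ∧
      ∃ M : ℝ, 0 < M ∧ variance (fun ω => (X i ω : ℝ)) μ ≤ 180 / M ^ 2 ∧
        |differentialEntropy μ (sumXU X U) - shannonEntropy μ (sumX X)|
          ≤ ((n : ℝ) - 1) * (2 * M) := by
  obtain ⟨M, hM, hTV, -, hvar⟩ := exists_log_concave_bound (h.measurable_X i) (h.logConcave_X i)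
  have hR : Measurable (∑ j ∈ Finset.univ.erase i, X j) :=
    h.measurable_sum_X _
  have hsum : ∑ j ∈ Finset.univ.erase i, X j + X i = sumX X := by
    rw [Finset.sum_erase_add _ _ (Finset.mem_univ i)]
    ext ω
    simp [sumX]
  obtain ⟨hS, hle⟩ := summable_abs_sub_pmfZ_add (h.measurable_X i) hR
    (h.iIndep_X.indepFun_finsetSum_of_notMem h.measurable_X (Finset.notMem_erase i _)) hTV
  rw [hsum] at hS hle
  have hV : Measurable (∑ j ∈ Finset.univ.erase i, U j) :=
    h.measurable_sum_U _
  have := Measure.isProbabilityMeasure_map (μ := μ) hV.aemeasurable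
  obtain ⟨hint, hlow, hup⟩ := integral_negMulLog_smoothed pmfZ_nonneg
    (hasSum_pmfZ h.measurable_sumX) h.summable_negMulLog (h.ae_mem_Icc (Finset.univ.erase i)) hS
  have hae : (fun x => Real.negMulLog (density μ (sumXU X U) x)) =ᵐ[volume] fun x =>
      Real.negMulLog (smoothed (pmfZ μ (sumX X)) (μ.map (∑ j ∈ Finset.univ.erase i, U j)) x) :=
    (h.density_ae_eq i).fun_comp Real.negMulLog
  refine ⟨hint.congr hae.symm, M, hM, hvar, ?_⟩
  -- One uniform is already used, so the smoothing variable ranges over `[0, n - 1]`.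
  have hcard : (((Finset.univ.erase i).card : ℕ) : ℝ) = (n : ℝ) - 1 := by
    rw [Finset.card_erase_of_mem (Finset.mem_univ i), Finset.card_univ, Fintype.card_fin,
      Nat.cast_sub (Fin.pos i), Nat.cast_one]
  rw [differentialEntropy, integral_congr_ae hae, shannonEntropy, abs_of_nonneg (by linarith)]
  rw [hcard] at hup
  have hn : (0 : ℝ) ≤ (n : ℝ) - 1 := by rw [← hcard]; positivity
  have := mul_le_mul_of_nonneg_left hle hn
  linarith

theorem abs_entropy_sub_le (hn : 1 ≤ n) (h : IsIIDLogConcaveUniform μ X U) {σ : ℝ} (hσ : 0 < σ)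
    (hX : HasCommonStdDev μ X σ) :
    |differentialEntropy μ (sumXU X U) - shannonEntropy μ (sumX X)| ≤ 28 * ((n : ℝ) - 1) / σ := by
  obtain ⟨-, M, hM, hvar, hle⟩ := h.entropy_bounds ⟨0, hn⟩
  rw [hX.2, le_div_iff₀ (by positivity)] at hvar
  -- From `(M σ)² ≤ 180 < 14²`.
  have hMσ : M ≤ 14 / σ := by
    rw [le_div_iff₀ hσ]
    refine abs_le_of_sq_le_sq' ?_ (by norm_num) |>.2
    nlinarith
  have hn' : (0 : ℝ) ≤ (n : ℝ) - 1 := by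
    have : (1 : ℝ) ≤ n := by exact_mod_cast hn
    linarith
  calc _ ≤ ((n : ℝ) - 1) * (2 * M) := hle
    _ ≤ ((n : ℝ) - 1) * (2 * (14 / σ)) := by gcongr
    _ = 28 * ((n : ℝ) - 1) / σ := by ring

end IsIIDLogConcaveUniform

/-! ### Comparison with the explicit error bound. -/

theorem seven_mul_pred_mul_le (n : ℕ) (hn : 1 ≤ n) :
    7 * (((n : ℝ) - 1) * n) ≤ 6 * 2 ^ n := by
  rcases Nat.lt_or_ge n 4 with h | h
  · interval_cases n <;> norm_num
  · induction n, h using Nat.le_induction with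
    | base => norm_num
    | succ k hk ih =>
      have h4 : (4 : ℝ) ≤ k := by exact_mod_cast hk
      have := ih (by omega)
      rw [pow_succ]
      push_cast
      nlinarith

/-- The other two terms are nonnegative and can be dropped. The threshold `3 ^ 7` makes the
logarithm at least `6`, which reduces the claim to `7 (n - 1) n ≤ 6 * 2 ^ n`. -/
theorem le_errorBound {n : ℕ} (hn : 1 ≤ n) {σ : ℝ}
    (hσ : max (2 ^ (n + 2) / √n) (3 ^ 7 / √n) < σ) :
    28 * ((n : ℝ) - 1) / σ ≤ errorBound n σ := by
  have hn1 : (1 : ℝ) ≤ n := by exact_mod_cast hn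
  have hs1 : 1 ≤ √(n : ℝ) := Real.one_le_sqrt.2 hn1
  have hs : 0 < √(n : ℝ) := by linarith
  have hsn : √(n : ℝ) ≤ n := by
    nlinarith [Real.mul_self_sqrt (by linarith : (0 : ℝ) ≤ n)]
  have h37 := (le_max_right _ _).trans_lt hσ
  have hσ0 : 0 < σ := lt_trans (by positivity) h37
  rw [div_lt_iff₀ hs] at h37
  have hsq : (n : ℝ) * σ ^ 2 = (σ * √n) ^ 2 := by
    rw [mul_pow, Real.sq_sqrt (by linarith)]; ring
  have h8 : (8 : ℝ) ≤ 2 ^ (n + 2) := by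
    calc (8 : ℝ) = 2 ^ 3 := by norm_num
      _ ≤ 2 ^ (n + 2) := pow_le_pow_right₀ one_le_two (by omega)
  have hlog : 6 ≤ Real.log (2 ^ (n + 2) * σ * √n) := by
    have hx : (3 : ℝ) ^ 6 ≤ 2 ^ (n + 2) * σ * √n := by
      rw [mul_assoc]
      nlinarith
    rw [Real.le_log_iff_exp_le (by positivity)]
    refine le_trans ?_ hx
    calc Real.exp 6 = Real.exp 1 ^ 6 := by rw [← Real.exp_nat_mul]; norm_num
      _ ≤ 3 ^ 6 := by
        gcongr
        linarith [Real.exp_one_lt_d9]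
  have hmain : 28 * ((n : ℝ) - 1) / σ ≤
      2 ^ (n + 2) / (σ * √n) * Real.log (2 ^ (n + 2) * σ * √n) := by
    calc 28 * ((n : ℝ) - 1) / σ = 4 * (7 * (((n : ℝ) - 1) * √n)) / (σ * √n) := by
          field_simp
          ring
      _ ≤ 4 * (6 * 2 ^ n) / (σ * √n) := by
          have h1 := seven_mul_pred_mul_le n hn
          have h2 : ((n : ℝ) - 1) * √n ≤ ((n : ℝ) - 1) * n :=
            mul_le_mul_of_nonneg_left hsn (by linarith)
          have h3 : 4 * (7 * (((n : ℝ) - 1) * √n)) ≤ 4 * (6 * 2 ^ n) := by linarith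
          gcongr
      _ = 2 ^ (n + 2) / (σ * √n) * 6 := by rw [pow_add]; ring
      _ ≤ _ := by gcongr
  have hexp : 0 ≤ 2 ^ (n + 6) * Real.exp (-(√n * σ) ^ (1 / 5 : ℝ)) * (√n * σ) ^ 3 := by positivity
  have hlast : 0 ≤ Real.log (n * σ ^ 2) / (8 * (n * σ ^ 2)) := by
    refine div_nonneg (Real.log_nonneg ?_) (by positivity)
    rw [hsq]
    exact one_le_pow₀ (by linarith)
  rw [errorBound]
  linarith

end LogConcaveSums

open LogConcaveSums in
theorem theorem1 (n : ℕ) (hn : 1 ≤ n) :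
    -- all quantities in the statement are well defined
    (∀ {Ω : Type u} [MeasurableSpace Ω] (μ : Measure Ω) [IsProbabilityMeasure μ]
        (X : Fin n → Ω → ℤ) (U : Fin n → Ω → ℝ), IsIIDLogConcaveUniform μ X U →
        (∀ i, MemLp (fun ω => (X i ω : ℝ)) 2 μ) ∧
        Summable (fun k : ℤ => Real.negMulLog (pmfZ μ (sumX X) k)) ∧
        HasPDF (sumXU X U) μ volume ∧
        Integrable (fun x : ℝ => Real.negMulLog (density μ (sumXU X U) x))) ∧
    -- the difference of the entropies vanishes as `σ → ∞`, at a rate that depends only on `n`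
    (∀ ε : ℝ, 0 < ε → ∃ σ₀ : ℝ,
      ∀ {Ω : Type u} [MeasurableSpace Ω] (μ : Measure Ω) [IsProbabilityMeasure μ]
        (X : Fin n → Ω → ℤ) (U : Fin n → Ω → ℝ) (σ : ℝ), IsIIDLogConcaveUniform μ X U →
        HasCommonStdDev μ X σ → σ₀ < σ →
        |differentialEntropy μ (sumXU X U) - shannonEntropy μ (sumX X)| ≤ ε) ∧
    -- the explicit bound
    (∀ {Ω : Type u} [MeasurableSpace Ω] (μ : Measure Ω) [IsProbabilityMeasure μ]
        (X : Fin n → Ω → ℤ) (U : Fin n → Ω → ℝ) (σ : ℝ), IsIIDLogConcaveUniform μ X U →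
        HasCommonStdDev μ X σ →
        max (2 ^ (n + 2) / √n) (3 ^ 7 / √n) < σ →
        |differentialEntropy μ (sumXU X U) - shannonEntropy μ (sumX X)| ≤ errorBound n σ) := by
  refine ⟨fun μ _ X U h => ⟨h.memLp_two, h.summable_negMulLog, h.hasPDF_sumXU ⟨0, hn⟩,
    (h.entropy_bounds ⟨0, hn⟩).1⟩, fun ε hε => ⟨28 * n / ε, ?_⟩, ?_⟩
  · intro Ω _ μ _ X U σ h hX hσ
    have hσ0 : 0 < σ := lt_of_le_of_lt (by positivity) hσ
    refine (h.abs_entropy_sub_le hn hσ0 hX).trans ?_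
    rw [div_lt_iff₀ hε] at hσ
    rw [div_le_iff₀ hσ0]
    linarith
  · intro Ω _ μ _ X U σ h hX hσ
    have hσ0 : 0 < σ := lt_of_le_of_lt (le_max_of_le_left (by positivity)) hσ
    exact (h.abs_entropy_sub_le hn hσ0 hX).trans (le_errorBound hn hσ)
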